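/- Let $N\ge 2$ and let $\Omega\subset\mathbb R^N$ be a bounded domain with Lipschitz boundary. For a function $p$ on $\Omega$ write $p_-=\inf_\Omega p$ and $p_+=\sup_\Omega p$. Let $\mathscr C$ be the set of all $p\in C(\overline\Omega)$ such that $1<p_-\le p_+<N$ and such that, for some $L>0$, $|p(x)-p(y)|\le -L/\log|x-y|$ for all $x,y\in\Omega$ with $0<|x-y|\le 1/2$. For $p\in\mathscr C$ put $\varrho_{p(x)}(u)=\int_\Omega|u(x)|^{p(x)}\,dx$, let $L^{p(x)}(\Omega)$ be the space of measurable functions $u$ with $\varrho_{p(x)}(u)<\infty$, with the Luxemburg norm $\|u\|_{p(x)}=\inf\{\gamma>0:\varrho_{p(x)}(u/\gamma)\le 1\}$ (and likewise for vector-valued functions), and let $W^{1,p(x)}_0(\Omega)$ be the closure of $C^\infty_c(\Omega)$ in $W^{1,p(x)}(\Omega)=\{u\in L^{p(x)}(\Omega):\nabla u\in L^{p(x)}(\Omega)\}$, where $\nabla u$ is the distributional gradient, with respect to the norm $\|u\|_{p(x)}+\|\nabla u\|_{p(x)}$. For $u\in L^1(\Omega)$ define $$\mathscr E_{p(x)}(u)=\begin{cases}\|\nabla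 u\|_{p(x)}&\text{if }u\in W^{1,p(x)}_0(\Omega),\\+\infty&\text{otherwise,}\end{cases}\qquad g_{p(x)}(u)=\begin{cases}\|u\|_{p(x)}&\text{if }u\in L^{p(x)}(\Omega),\\0&\text{otherwise.}\end{cases}$$ **Theorem.** Let $p\in\mathscr C$ and $(p_h)_{h\in\mathbb N}\subset\mathscr C$ with $p_h\to p$ pointwise in $\Omega$, and suppose that for some $\bar h\in\mathbb N$ $$p_I:=\inf_{h\ge\bar h}(p_h)_->1\qquad\text{and}\qquad p_S:=\sup_{h\ge\bar h}(p_h)_+<p_I^*:=\frac{Np_I}{N-p_I}.$$ Then for every subsequence $(p_{h_n})$ of $(p_h)$ and every sequence $(u_n)\subset L^1(\Omega)$ with $\sup_{n\in\mathbb N}\mathscr E_{p_{h_n}(x)}(u_n)<\infty$ there exist a subsequence $(u_{n_j})$ and a function $u\in L^1(\Omega)\cap L^{p(x)}(\Omega)$ such that, as $j\to\infty$, $$u_{n_j}\to u\ \text{ in }L^1(\Omega)\qquad\text{and}\qquad g_{p_{h_{n_j}}(x)}(u_{n_j})\to g_{p(x)}(u),$$ that is, $\|u_{n_j}\|_{p_{h_{n_j}}(x)}\to\|u\|_{p(x)}$.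 -/

import Mathlib

open MeasureTheory Filter Topology Set

noncomputable section

namespace VarExp

/-- The Euclidean space `ℝ^N`. -/
abbrev Eu (N : ℕ) : Type := EuclideanSpace ℝ (Fin N)

/-- Lipschitz boundary: near each boundary point, `Ω` is the strict epigraph, in some unit
direction `ν`, of a Lipschitz function `φ` of the component orthogonal to `ν`. -/
def HasLipschitzBoundary {N : ℕ} (Ω : Set (Eu N)) : Prop :=
  ∀ x₀ ∈ frontier Ω, ∃ r : ℝ, 0 < r ∧ ∃ ν : Eu N, ‖ν‖ = 1 ∧
    ∃ (K : NNReal) (φ : Eu N → ℝ), LipschitzWith K φ ∧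
      ∀ y ∈ Metric.ball x₀ r, (y ∈ Ω ↔ φ (y - inner ℝ ν y • ν) < inner ℝ ν y)

/-- A bounded domain (nonempty, connected, open set) with Lipschitz boundary. -/
structure IsBoundedLipschitzDomain {N : ℕ} (Ω : Set (Eu N)) : Prop where
  isOpen : IsOpen Ω
  isConnected : IsConnected Ω
  isBounded : Bornology.IsBounded Ω
  lipschitz : HasLipschitzBoundary Ω

/-- `p₋ = inf_Ω p`. -/
def expInf {N : ℕ} (Ω : Set (Eu N)) (p : Eu N → ℝ) : ℝ := sInf (p '' Ω)

/-- `p₊ = sup_Ω p`. -/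
def expSup {N : ℕ} (Ω : Set (Eu N)) (p : Eu N → ℝ) : ℝ := sSup (p '' Ω)

/-- The class of admissible exponents: continuous on the closure of `Ω`, `1 < p₋ ≤ p₊ < N`,
and log-Hölder continuous in `Ω`. Only the values on the closure of `Ω` matter. -/
structure Admissible {N : ℕ} (Ω : Set (Eu N)) (p : Eu N → ℝ) : Prop where
  continuousOn : ContinuousOn p (closure Ω)
  one_lt : 1 < expInf Ω p
  lt_dim : expSup Ω p < N
  logHolder : ∃ L : ℝ, 0 < L ∧ ∀ x ∈ Ω, ∀ y ∈ Ω, 0 < ‖x - y‖ → ‖x - y‖ ≤ 1 / 2 →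
    |p x - p y| ≤ -(L / Real.log ‖x - y‖)

/-- The `p(x)`-modular `∫_Ω |f|^{p(x)} dx`, for scalar or vector valued `f`. -/
def modular {N : ℕ} {F : Type*} [NormedAddCommGroup F]
    (Ω : Set (Eu N)) (p : Eu N → ℝ) (f : Eu N → F) : ENNReal :=
  ∫⁻ x in Ω, ‖f x‖ₑ ^ p x

/-- Membership in the variable exponent Lebesgue space `L^{p(x)}(Ω)`. -/
def MemLpVar {N : ℕ} {F : Type*} [NormedAddCommGroup F]
    (Ω : Set (Eu N)) (p : Eu N → ℝ) (f : Eu N → F) : Prop :=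
  AEStronglyMeasurable f (volume.restrict Ω) ∧ modular Ω p f < ⊤

/-- The Luxemburg norm `inf {γ > 0 : ϱ_{p(x)}(f / γ) ≤ 1}`. -/
def luxNorm {N : ℕ} {F : Type*} [NormedAddCommGroup F] [NormedSpace ℝ F]
    (Ω : Set (Eu N)) (p : Eu N → ℝ) (f : Eu N → F) : ℝ :=
  sInf {γ : ℝ | 0 < γ ∧ modular Ω p (fun x => γ⁻¹ • f x) ≤ 1}

/-- `φ ∈ C_c^∞(Ω)`. -/
def IsTest {N : ℕ} (Ω : Set (Eu N)) (φ : Eu N → ℝ) : Prop :=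
  ContDiff ℝ (⊤ : ℕ∞) φ ∧ HasCompactSupport φ ∧ tsupport φ ⊆ Ω

/-- `G` is a distributional gradient of `u` in `Ω`. -/
def IsWeakGrad {N : ℕ} (Ω : Set (Eu N)) (u : Eu N → ℝ) (G : Eu N → Eu N) : Prop :=
  LocallyIntegrableOn u Ω ∧ LocallyIntegrableOn G Ω ∧
    ∀ φ : Eu N → ℝ, IsTest Ω φ → ∀ i : Fin N,
      ∫ x in Ω, u x * gradient φ x i = -∫ x in Ω, G x i * φ x

open Classical in
/-- The distributional gradient of `u` in `Ω` (unique up to null sets of `Ω`);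
`0` if `u` has no locally integrable distributional gradient. -/
def weakGrad {N : ℕ} (Ω : Set (Eu N)) (u : Eu N → ℝ) : Eu N → Eu N :=
  if h : ∃ G, IsWeakGrad Ω u G then h.choose else 0

/-- Membership in `W^{1,p(x)}(Ω)`. -/
def MemW1 {N : ℕ} (Ω : Set (Eu N)) (p : Eu N → ℝ) (u : Eu N → ℝ) : Prop :=
  MemLpVar Ω p u ∧ (∃ G, IsWeakGrad Ω u G) ∧ MemLpVar Ω p (weakGrad Ω u)

/-- Membership in `W_0^{1,p(x)}(Ω)`, the closure of `C_c^∞(Ω)` in `W^{1,p(x)}(Ω)` for the norm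
`‖u‖_{p(x)} + ‖∇u‖_{p(x)}`. -/
def MemW10 {N : ℕ} (Ω : Set (Eu N)) (p : Eu N → ℝ) (u : Eu N → ℝ) : Prop :=
  MemW1 Ω p u ∧ ∀ ε : ℝ, 0 < ε → ∃ φ : Eu N → ℝ, IsTest Ω φ ∧
    luxNorm Ω p (fun x => u x - φ x) +
      luxNorm Ω p (fun x => weakGrad Ω u x - gradient φ x) < ε

/-- The space `L¹(Ω)`. -/
abbrev L1 {N : ℕ} (Ω : Set (Eu N)) : Type := Lp ℝ 1 (volume.restrict Ω)

open Classical in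
/-- The functional on `L¹(Ω)` equal to `‖∇u‖_{p(x)}` on `W_0^{1,p(x)}(Ω)` and `+∞` elsewhere. -/
def energy {N : ℕ} (Ω : Set (Eu N)) (p : Eu N → ℝ) (u : L1 Ω) : ENNReal :=
  if MemW10 Ω p u then ENNReal.ofReal (luxNorm Ω p (weakGrad Ω u)) else ⊤

open Classical in
/-- The functional on `L¹(Ω)` equal to `‖u‖_{p(x)}` on `L^{p(x)}(Ω)` and `0` elsewhere. -/
def gNorm {N : ℕ} (Ω : Set (Eu N)) (p : Eu N → ℝ) (u : L1 Ω) : ℝ :=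
  if MemLpVar Ω p u then luxNorm Ω p u else 0

/-- `p_I = inf_{h ≥ h̄} (p_h)₋`. -/
def tailInf {N : ℕ} (Ω : Set (Eu N)) (ph : ℕ → Eu N → ℝ) (hbar : ℕ) : ℝ :=
  sInf ((fun h => expInf Ω (ph h)) '' Ici hbar)

/-- `p_S = sup_{h ≥ h̄} (p_h)₊`. -/
def tailSup {N : ℕ} (Ω : Set (Eu N)) (ph : ℕ → Eu N → ℝ) (hbar : ℕ) : ℝ :=
  sSup ((fun h => expSup Ω (ph h)) '' Ici hbar)

/-- The critical Sobolev exponent `q^* = N q / (N - q)`, for `q < N`. -/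
def sobolevConj (N : ℕ) (q : ℝ) : ℝ := N * q / (N - q)

end VarExp

end

/-! Each `u n` is replaced by a test function `φ n` whose Luxemburg distance to it, gradients
included, is below `1 / (n + 1)`. The exponents are at least `q = p_I`, so the energy bound controls
`∇φ n` in the constant-exponent space `L^q`. The Gagliardo–Nirenberg–Sobolev inequality then bounds
`φ n` in `L^{q*}`, and Rellich's theorem (`exists_subseq_tendsto_lintegral`) gives a subsequence
converging in `L¹` and almost everywhere.

The exponents are also at most `p_S < q*`, so for each `γ > 0` the functions `|φ n / γ|^{P n}` are
bounded in `L^{q*/p_S}`, a power above one. Vitali's theorem (`tendsto_lintegral_of_rpow_bound`)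
makes the modulars of `φ n / γ` converge, although the exponents move with `n`. Convergence of
modulars at every scale `γ` forces convergence of the Luxemburg norms (`tendsto_luxNorm`), and the
approximation error vanishes when returning to `u n`. -/

noncomputable section

namespace VarExp

variable {N : ℕ}

/-! ### Translation averages and Rellich compactness in `L¹`. -/

/-- Translating a `C¹` function by `z` changes it in `L¹` by at most `‖z‖ ‖∇f‖₁`. -/
theorem lintegral_enorm_translate_sub_le {f : Eu N → ℝ} (hf : ContDiff ℝ 1 f) (z : Eu N) :
    ∫⁻ x, ‖f (z + x) - f x‖ₑ ≤ ‖z‖ₑ * ∫⁻ x, ‖fderiv ℝ f x‖ₑ := by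
  have hc : Continuous (fderiv ℝ f) := hf.continuous_fderiv one_ne_zero
  have key : ∀ x, ‖f (z + x) - f x‖ₑ ≤
      ∫⁻ t in Ioc (0 : ℝ) 1, ‖fderiv ℝ f (x + t • z)‖ₑ * ‖z‖ₑ := by
    intro x
    have hd : ∀ t ∈ uIcc (0 : ℝ) 1,
        HasDerivAt (fun t : ℝ => f (x + t • z)) (fderiv ℝ f (x + t • z) z) t := by
      intro t _
      have h1 : HasDerivAt (fun t : ℝ => x + t • z) z t := by
        simpa using ((hasDerivAt_id t).smul_const z).const_add x
      exact ((hf.differentiable one_ne_zero _).hasFDerivAt).comp_hasDerivAt t h1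
    have hci : Continuous fun t : ℝ => fderiv ℝ f (x + t • z) z := by fun_prop
    have := intervalIntegral.integral_eq_sub_of_hasDerivAt hd (hci.intervalIntegrable 0 1)
    have h2 : f (z + x) - f x = ∫ t in (0 : ℝ)..1, fderiv ℝ f (x + t • z) z := by
      rw [this]; simp [add_comm]
    rw [h2, intervalIntegral.integral_of_le zero_le_one]
    refine (enorm_integral_le_lintegral_enorm _).trans (lintegral_mono fun t => ?_)
    exact ContinuousLinearMap.le_opENorm _ _
  calc ∫⁻ x, ‖f (z + x) - f x‖ₑ
      ≤ ∫⁻ x, ∫⁻ t in Ioc (0 : ℝ) 1, ‖fderiv ℝ f (x + t • z)‖ₑ * ‖z‖ₑ := lintegral_mono key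
    _ = ∫⁻ t in Ioc (0 : ℝ) 1, ∫⁻ x, ‖fderiv ℝ f (x + t • z)‖ₑ * ‖z‖ₑ := by
        apply lintegral_lintegral_swap
        refine Continuous.aemeasurable ?_
        have h : Continuous fun w : Eu N × ℝ => ‖fderiv ℝ f (w.1 + w.2 • z)‖ₑ := by fun_prop
        exact (ENNReal.continuous_mul_const (by simp)).comp h
    _ = ‖z‖ₑ * ∫⁻ x, ‖fderiv ℝ f x‖ₑ := by
        have : ∀ t : ℝ, ∫⁻ x, ‖fderiv ℝ f (x + t • z)‖ₑ * ‖z‖ₑ =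
            ‖z‖ₑ * ∫⁻ x, ‖fderiv ℝ f x‖ₑ := by
          intro t
          rw [lintegral_mul_const' _ _ (by simp), mul_comm,
            lintegral_add_right_eq_self (fun x => ‖fderiv ℝ f x‖ₑ) (t • z)]
        simp [this]

/-- For every `δ > 0` there is a probability measure concentrated on the ball of radius `δ`
with a bounded density. -/
theorem exists_averaging_measure {δ : ℝ} (hδ : 0 < δ) :
    ∃ (ν : Measure (Eu N)) (K : ENNReal), IsProbabilityMeasure ν ∧ K ≠ ⊤ ∧
      (∀ g : Eu N → ENNReal, ∫⁻ z, g z ∂ν ≤ K * ∫⁻ z, g z) ∧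
      ∀ᵐ z ∂ν, ‖z‖ₑ ≤ ENNReal.ofReal δ := by
  have h0 : volume (Metric.ball (0 : Eu N) δ) ≠ 0 := (Metric.measure_ball_pos _ _ hδ).ne'
  refine ⟨ProbabilityTheory.cond volume (Metric.ball 0 δ),
    (volume (Metric.ball (0 : Eu N) δ))⁻¹, 
    ProbabilityTheory.cond_isProbabilityMeasure_of_finite h0 measure_ball_lt_top.ne,
    by simpa using h0, fun g => ?_, ?_⟩
  · rw [ProbabilityTheory.cond, lintegral_smul_measure, smul_eq_mul]
    gcongr
    exact Measure.restrict_le_self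
  · rw [ProbabilityTheory.cond]
    refine Measure.ae_smul_measure ?_ _
    filter_upwards [ae_restrict_mem measurableSet_ball] with z hz
    rw [← ofReal_norm]
    exact ENNReal.ofReal_le_ofReal (by simpa using (mem_ball_zero_iff.1 hz).le)

/-- The average of the translates of `f` with respect to `ν`. -/
def translateAvg (ν : Measure (Eu N)) (f : Eu N → ℝ) (x : Eu N) : ℝ := ∫ z, f (x + z) ∂ν

section Avg

variable {ν : Measure (Eu N)} {K : ENNReal}
  {f : Eu N → ℝ}

theorem integrable_translate [IsProbabilityMeasure ν] (hf : ContDiff ℝ 1 f)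
    (hs : HasCompactSupport f) (x : Eu N) : Integrable (fun z => f (x + z)) ν := by
  obtain ⟨C, hC⟩ := hs.exists_bound_of_continuous hf.continuous
  refine Integrable.of_bound (C := C) ?_ (Eventually.of_forall fun z => hC _)
  exact (hf.continuous.comp (by fun_prop)).aestronglyMeasurable

/-- The bounded density of `ν` turns an `L¹` bound into a uniform one. -/
theorem enorm_translateAvg_le (hK : ∀ g : Eu N → ENNReal, ∫⁻ z, g z ∂ν ≤ K * ∫⁻ z, g z)
    (x : Eu N) : ‖translateAvg ν f x‖ₑ ≤ K * ∫⁻ y, ‖f y‖ₑ := by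
  refine (enorm_integral_le_lintegral_enorm _).trans ((hK _).trans ?_)
  rw [lintegral_add_left_eq_self (fun y => ‖f y‖ₑ) x]

/-- The difference of two averages integrates `f (x - y + ·) - f`, so bounded density and the `L¹`
translation estimate give a Lipschitz constant depending only on `K` and `‖∇f‖₁`. This
equicontinuity lets finitely many sample values determine the averages. -/
theorem edist_translateAvg_le [IsProbabilityMeasure ν]
    (hK : ∀ g : Eu N → ENNReal, ∫⁻ z, g z ∂ν ≤ K * ∫⁻ z, g z)
    (hf : ContDiff ℝ 1 f) (hs : HasCompactSupport f) (x y : Eu N) :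
    ‖translateAvg ν f x - translateAvg ν f y‖ₑ ≤
      K * (‖x - y‖ₑ * ∫⁻ y, ‖fderiv ℝ f y‖ₑ) := by
  rw [translateAvg, translateAvg,
    ← integral_sub (integrable_translate hf hs x) (integrable_translate hf hs y)]
  refine (enorm_integral_le_lintegral_enorm _).trans ((hK _).trans ?_)
  gcongr
  refine le_trans (le_of_eq ?_) (lintegral_enorm_translate_sub_le hf (x - y))
  rw [← lintegral_add_left_eq_self (fun w => ‖f (x - y + w) - f w‖ₑ) y]
  congr 1 with z
  congr 3
  abel

theorem continuous_translateAvg [IsProbabilityMeasure ν] (hf : ContDiff ℝ 1 f)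
    (hs : HasCompactSupport f) : Continuous (translateAvg ν f) := by
  obtain ⟨C, hC⟩ := hs.exists_bound_of_continuous hf.continuous
  refine continuous_of_dominated (bound := fun _ => C) (fun x => ?_)
    (fun x => Eventually.of_forall fun z => hC _) (integrable_const C)
    (Eventually.of_forall fun z => hf.continuous.comp (by fun_prop))
  exact (integrable_translate hf hs x).aestronglyMeasurable

theorem lintegral_enorm_sub_translateAvg_le [IsProbabilityMeasure ν] {δ : ENNReal}
    (hδ : ∀ᵐ z ∂ν, ‖z‖ₑ ≤ δ) (hf : ContDiff ℝ 1 f) (hs : HasCompactSupport f) :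
    ∫⁻ x, ‖f x - translateAvg ν f x‖ₑ ≤ δ * ∫⁻ y, ‖fderiv ℝ f y‖ₑ := by
  have key : ∀ x, ‖f x - translateAvg ν f x‖ₑ ≤ ∫⁻ z, ‖f (z + x) - f x‖ₑ ∂ν := by
    intro x
    have : translateAvg ν f x - f x = ∫ z, (f (x + z) - f x) ∂ν := by
      rw [integral_sub (integrable_translate hf hs x) (integrable_const _)]
      simp [translateAvg]
    rw [← enorm_neg, neg_sub, this]
    refine (enorm_integral_le_lintegral_enorm _).trans (le_of_eq ?_)
    simp_rw [add_comm]
  calc ∫⁻ x, ‖f x - translateAvg ν f x‖ₑ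
      ≤ ∫⁻ x, (∫⁻ z, ‖f (z + x) - f x‖ₑ ∂ν) := lintegral_mono key
    _ = ∫⁻ z, (∫⁻ x, ‖f (z + x) - f x‖ₑ) ∂ν := by
        apply lintegral_lintegral_swap
        have hfc := hf.continuous
        have : Continuous (Function.uncurry fun (x z : Eu N) => ‖f (z + x) - f x‖ₑ) := by
          have : Continuous fun w : Eu N × Eu N => ‖f (w.2 + w.1) - f w.1‖ₑ := by fun_prop
          exact this
        exact this.aemeasurable
    _ ≤ ∫⁻ _, (δ * ∫⁻ y, ‖fderiv ℝ f y‖ₑ) ∂ν := by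
        refine lintegral_mono_ae (hδ.mono fun z hz => ?_)
        exact (lintegral_enorm_translate_sub_le hf z).trans (by gcongr)
    _ = δ * ∫⁻ y, ‖fderiv ℝ f y‖ₑ := by simp

end Avg

/-- A sequence is totally bounded if, up to any error, it can be recovered from a bounded sequence
of vectors with finitely many coordinates. -/
theorem totallyBounded_range_of_discretization {X : Type*} [PseudoEMetricSpace X] (a : ℕ → X)
    (h : ∀ ε : ENNReal, 0 < ε → ∃ (T : Finset (Eu N)) (c : ℕ → T → ℝ),
      Bornology.IsBounded (range c) ∧ ∃ η : ℝ, 0 < η ∧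
        ∀ i j, dist (c i) (c j) < η → edist (a i) (a j) < ε) :
    TotallyBounded (range a) := by
  rw [EMetric.totallyBounded_iff]
  intro ε hε
  obtain ⟨T, c, hb, η, hη, hc⟩ := h ε hε
  have htb : TotallyBounded (range c) := hb.isCompact_closure.totallyBounded.subset subset_closure
  obtain ⟨t, hts, htf, hcov⟩ := Metric.finite_approx_of_totallyBounded htb η hη
  have hpre : ∀ y ∈ t, ∃ i, c i = y := fun y hy => hts hy
  choose! g hg using hpre
  refine ⟨(fun y => a (g y)) '' t, htf.image _, ?_⟩
  rintro _ ⟨i, rfl⟩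
  obtain ⟨y, hy, hiy⟩ := mem_iUnion₂.1 (hcov (mem_range_self i))
  refine mem_iUnion₂.2 ⟨_, mem_image_of_mem _ hy, hc _ _ ?_⟩
  rw [hg y hy]
  exact hiy

/-- **Rellich's compactness theorem** in `L¹(Ω)`. -/
theorem exists_subseq_tendsto_lintegral {Ω : Set (Eu N)} (hΩ : Bornology.IsBounded Ω)
    (hm : MeasurableSet Ω)
    {φ : ℕ → Eu N → ℝ} (hφ : ∀ n, ContDiff ℝ 1 (φ n)) (hs : ∀ n, HasCompactSupport (φ n))
    {M D : ENNReal} (hM : M ≠ ⊤) (hD : D ≠ ⊤) (hφM : ∀ n, ∫⁻ x, ‖φ n x‖ₑ ≤ M)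
    (hφD : ∀ n, ∫⁻ x, ‖fderiv ℝ (φ n) x‖ₑ ≤ D) :
    ∃ (s : ℕ → ℕ) (v : L1 Ω), StrictMono s ∧
      Tendsto (fun j => ∫⁻ x in Ω, ‖φ (s j) x - v x‖ₑ) atTop (𝓝 0) := by
  have hL : ∀ n, MemLp (φ n) 1 (volume.restrict Ω) := fun n =>
    ((hφ n).continuous.memLp_of_hasCompactSupport (hs n)).restrict Ω
  have hV : volume Ω ≠ ⊤ := hΩ.measure_lt_top.ne
  have htb : TotallyBounded (range fun n => (hL n).toLp (φ n)) := by
    refine totallyBounded_range_of_discretization (N := N) _ fun ε hε => ?_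
    -- Five errors are to be absorbed: two from replacing `φ i`, `φ j` by their averages, two from
    -- moving to a nearby net point, one from comparing the averages there.
    have he : ε / 5 ≠ 0 := (ENNReal.div_pos hε.ne' (by norm_num)).ne'
    obtain ⟨δ, hδ, hδD⟩ := ENNReal.exists_nnreal_pos_mul_lt hD he
    obtain ⟨ν, K, hν, hK, hνK, hνδ⟩ := exists_averaging_measure (N := N) (NNReal.coe_pos.2 hδ)
    rw [ENNReal.ofReal_coe_nnreal] at hνδ
    obtain ⟨η, hη, hηD⟩ := ENNReal.exists_nnreal_pos_mul_lt
      (ENNReal.mul_ne_top (ENNReal.mul_ne_top hK hD) hV) he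
    obtain ⟨η', hη', hηV⟩ := ENNReal.exists_nnreal_pos_mul_lt hV he
    -- The coordinates are the values of the averages on a finite `η`-net of `Ω`.
    obtain ⟨T, -, hTf, hT⟩ := Metric.finite_approx_of_totallyBounded
      (hΩ.isCompact_closure.totallyBounded.subset subset_closure) η (NNReal.coe_pos.2 hη)
    lift T to Finset (Eu N) using hTf
    refine ⟨T, fun i t => translateAvg ν (φ i) t, ?_, η', NNReal.coe_pos.2 hη', fun i j hij => ?_⟩
    · refine isBounded_iff_forall_norm_le.2 ⟨(K * M).toReal, ?_⟩
      rintro _ ⟨i, rfl⟩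
      refine (pi_norm_le_iff_of_nonneg ENNReal.toReal_nonneg).2 fun t => ?_
      rw [← toReal_enorm]
      refine ENNReal.toReal_mono (ENNReal.mul_ne_top hK hM) ?_
      exact (enorm_translateAvg_le hνK _).trans (by gcongr; exact hφM i)
    · rw [Lp.edist_toLp_toLp, eLpNorm_one_eq_lintegral_enorm]
      have hA : ∀ n, ∫⁻ x in Ω, ‖φ n x - translateAvg ν (φ n) x‖ₑ < ε / 5 := fun n =>
        ((setLIntegral_le_lintegral _ _).trans
          (lintegral_enorm_sub_translateAvg_le hνδ (hφ n) (hs n))).trans_lt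
          (lt_of_le_of_lt (by gcongr; exact hφD n) hδD)
      have hB : ∫⁻ x in Ω, ‖translateAvg ν (φ i) x - translateAvg ν (φ j) x‖ₑ <
          ε / 5 + (ε / 5 + ε / 5) := by
        have hpt : ∀ x ∈ Ω, ‖translateAvg ν (φ i) x - translateAvg ν (φ j) x‖ₑ ≤
            η * (K * D) + (η * (K * D) + η') := by
          intro x hx
          obtain ⟨t, ht, hxt⟩ := mem_iUnion₂.1 (hT hx)
          have hlip : ∀ n, ‖translateAvg ν (φ n) x - translateAvg ν (φ n) t‖ₑ ≤ η * (K * D) := by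
            intro n
            refine (edist_translateAvg_le hνK (hφ n) (hs n) x t).trans ?_
            have h1 : ‖x - t‖ₑ ≤ η := by
              rw [← ofReal_norm, ← dist_eq_norm, ← ENNReal.ofReal_coe_nnreal]
              exact ENNReal.ofReal_le_ofReal (Metric.mem_ball.1 hxt).le
            calc K * (‖x - t‖ₑ * ∫⁻ y, ‖fderiv ℝ (φ n) y‖ₑ) ≤ K * (η * D) := by
                  gcongr; exact hφD n
              _ = η * (K * D) := by ring
          have hmid : ‖translateAvg ν (φ i) t - translateAvg ν (φ j) t‖ₑ ≤ η' := by
            rw [← ofReal_norm, ← dist_eq_norm, ← ENNReal.ofReal_coe_nnreal]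
            refine ENNReal.ofReal_le_ofReal ?_
            exact ((dist_le_pi_dist (fun t : T => translateAvg ν (φ i) t)
              (fun t : T => translateAvg ν (φ j) t) ⟨t, ht⟩).trans hij.le)
          have hsplit : translateAvg ν (φ i) x - translateAvg ν (φ j) x =
              (translateAvg ν (φ i) x - translateAvg ν (φ i) t) +
              (-(translateAvg ν (φ j) x - translateAvg ν (φ j) t) +
                (translateAvg ν (φ i) t - translateAvg ν (φ j) t)) := by ring
          rw [hsplit]
          refine (enorm_add_le _ _).trans (add_le_add (hlip i) ((enorm_add_le _ _).trans ?_))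
          rw [enorm_neg]
          exact add_le_add (hlip j) hmid
        calc ∫⁻ x in Ω, ‖translateAvg ν (φ i) x - translateAvg ν (φ j) x‖ₑ
            ≤ ∫⁻ _ in Ω, (η * (K * D) + (η * (K * D) + η')) := setLIntegral_mono' hm hpt
          _ = η * (K * D * volume Ω) + (η * (K * D * volume Ω) + η' * volume Ω) := by
              rw [setLIntegral_const]; ring
          _ < _ := ENNReal.add_lt_add hηD (ENNReal.add_lt_add hηD hηV)
      have hcont : ∀ n, Continuous fun x => ‖φ n x - translateAvg ν (φ n) x‖ₑ := fun n =>
        ((hφ n).continuous.sub (continuous_translateAvg (hφ n) (hs n))).enorm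
      calc ∫⁻ x in Ω, ‖(φ i - φ j) x‖ₑ
          ≤ ∫⁻ x in Ω, (‖φ i x - translateAvg ν (φ i) x‖ₑ + (‖φ j x - translateAvg ν (φ j) x‖ₑ +
            ‖translateAvg ν (φ i) x - translateAvg ν (φ j) x‖ₑ)) := by
            refine lintegral_mono fun x => ?_
            have hsplit : (φ i - φ j) x = (φ i x - translateAvg ν (φ i) x) +
                (-(φ j x - translateAvg ν (φ j) x) +
                  (translateAvg ν (φ i) x - translateAvg ν (φ j) x)) := by
              simp only [Pi.sub_apply]; ring
            rw [hsplit]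
            refine (enorm_add_le _ _).trans (add_le_add le_rfl ((enorm_add_le _ _).trans ?_))
            rw [enorm_neg]
        _ = (∫⁻ x in Ω, ‖φ i x - translateAvg ν (φ i) x‖ₑ) +
            ((∫⁻ x in Ω, ‖φ j x - translateAvg ν (φ j) x‖ₑ) +
            ∫⁻ x in Ω, ‖translateAvg ν (φ i) x - translateAvg ν (φ j) x‖ₑ) := by
            rw [lintegral_add_left (hcont i).measurable, lintegral_add_left (hcont j).measurable]
        _ < ε / 5 + (ε / 5 + (ε / 5 + (ε / 5 + ε / 5))) :=
            ENNReal.add_lt_add (hA i) (ENNReal.add_lt_add (hA j) hB)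
        _ = 5 * (ε / 5) := by ring
        _ = ε := ENNReal.mul_div_cancel (by norm_num) (by norm_num)
  have hcpt := htb.closure.isCompact_of_isClosed isClosed_closure
  obtain ⟨v, -, s, hsm, hlim⟩ :=
    hcpt.tendsto_subseq (fun n => subset_closure (mem_range_self n))
  refine ⟨s, v, hsm, ?_⟩
  have := (Lp.tendsto_Lp_iff_tendsto_eLpNorm' _ _).1 hlim
  refine this.congr fun j => ?_
  rw [eLpNorm_one_eq_lintegral_enorm]
  refine lintegral_congr_ae ?_
  filter_upwards [(hL (s j)).coeFn_toLp] with x hx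
  simp [hx]

/-! ### Modulars and the Luxemburg norm. -/

/-- Pointwise substitute for Hölder's inequality: on a set of finite measure it lowers powers, even
variable ones, at the cost of the measure of the set. -/
theorem rpow_le_one_add_rpow (t : ENNReal) {a b : ℝ} (ha : 0 ≤ a) (hab : a ≤ b) :
    t ^ a ≤ 1 + t ^ b := by
  rcases le_total t 1 with h | h
  · exact (ENNReal.rpow_le_one h ha).trans le_self_add
  · exact (ENNReal.rpow_le_rpow_of_exponent_le h hab).trans le_add_self

section Modular

variable {F : Type*} [NormedAddCommGroup F] {Ω : Set (Eu N)} {p : Eu N → ℝ}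
  {f g : Eu N → F}

theorem aemeasurable_enorm_rpow (hp : AEMeasurable p (volume.restrict Ω))
    (hf : AEStronglyMeasurable f (volume.restrict Ω)) :
    AEMeasurable (fun x => ‖f x‖ₑ ^ p x) (volume.restrict Ω) :=
  hf.enorm.pow hp

theorem modular_lt_top_of_bounded (hm : MeasurableSet Ω) (hV : volume Ω < ⊤) {S C : ℝ}
    (hp : ∀ x ∈ Ω, 1 ≤ p x) (hS : ∀ x ∈ Ω, p x ≤ S) (hf : ∀ x, ‖f x‖ ≤ C) :
    modular Ω p f < ⊤ := by
  have hC : 0 ≤ C := (norm_nonneg _).trans (hf 0)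
  refine (setLIntegral_mono' (g := fun _ => 1 + ENNReal.ofReal C ^ S) hm fun x hx => ?_).trans_lt ?_
  · refine (rpow_le_one_add_rpow _ (zero_le_one.trans (hp x hx)) (hS x hx)).trans ?_
    have : 0 ≤ S := (zero_le_one.trans (hp x hx)).trans (hS x hx)
    gcongr
    rw [← ofReal_norm]
    exact ENNReal.ofReal_le_ofReal (hf x)
  · rw [setLIntegral_const]
    rcases Ω.eq_empty_or_nonempty with rfl | ⟨x, hx⟩
    · simp
    · have : 0 ≤ S := (zero_le_one.trans (hp x hx)).trans (hS x hx)
      exact ENNReal.mul_lt_top (ENNReal.add_lt_top.2 ⟨ENNReal.one_lt_top,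
        ENNReal.rpow_lt_top_of_nonneg this ENNReal.ofReal_ne_top⟩) hV

theorem modular_add_lt_top (hm : MeasurableSet Ω) (hpm : AEMeasurable p (volume.restrict Ω))
    {S : ℝ} (hp : ∀ x ∈ Ω, 1 ≤ p x) (hS : ∀ x ∈ Ω, p x ≤ S)
    (hfm : AEStronglyMeasurable f (volume.restrict Ω)) (hf : modular Ω p f < ⊤)
    (hg : modular Ω p g < ⊤) : modular Ω p (fun x => f x + g x) < ⊤ := by
  rcases Ω.eq_empty_or_nonempty with rfl | ⟨x₀, hx₀⟩
  · simp [modular]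
  have hS0 : 0 ≤ S := (zero_le_one.trans (hp x₀ hx₀)).trans (hS x₀ hx₀)
  have hfin : (2 : ENNReal) ^ S ≠ ⊤ := (ENNReal.rpow_lt_top_of_nonneg hS0 (by norm_num)).ne
  calc modular Ω p (fun x => f x + g x)
      ≤ ∫⁻ x in Ω, 2 ^ S * (‖f x‖ₑ ^ p x + ‖g x‖ₑ ^ p x) := by
        refine setLIntegral_mono' hm fun x hx => ?_
        have hp0 := zero_le_one.trans (hp x hx)
        calc ‖f x + g x‖ₑ ^ p x ≤ (‖f x‖ₑ + ‖g x‖ₑ) ^ p x := by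
              gcongr; exact enorm_add_le _ _
          _ ≤ 2 ^ (p x - 1) * (‖f x‖ₑ ^ p x + ‖g x‖ₑ ^ p x) :=
              ENNReal.rpow_add_le_mul_rpow_add_rpow _ _ (hp x hx)
          _ ≤ 2 ^ S * (‖f x‖ₑ ^ p x + ‖g x‖ₑ ^ p x) := by
              gcongr
              · norm_num
              · linarith [hS x hx]
    _ = 2 ^ S * (modular Ω p f + modular Ω p g) := by
        rw [lintegral_const_mul' _ _ hfin, lintegral_add_left' (aemeasurable_enorm_rpow hpm hfm)]
        rfl
    _ < ⊤ := ENNReal.mul_lt_top hfin.lt_top (ENNReal.add_lt_top.2 ⟨hf, hg⟩)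

variable [NormedSpace ℝ F]

/-- For `c ≤ 1 ≤ p` one has `c ^ p ≤ c`. This linear decay is what links the modular to the norm. -/
theorem modular_smul_le (hm : MeasurableSet Ω) (hp : ∀ x ∈ Ω, 1 ≤ p x) {c : ℝ} (h0 : 0 ≤ c)
    (h1 : c ≤ 1) : modular Ω p (fun x => c • f x) ≤ ENNReal.ofReal c * modular Ω p f := by
  rw [modular, modular, ← lintegral_const_mul' _ _ ENNReal.ofReal_ne_top]
  refine setLIntegral_mono' hm fun x hx => ?_
  rw [enorm_smul, ENNReal.mul_rpow_of_nonneg _ _ (zero_le_one.trans (hp x hx)),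
    Real.enorm_eq_ofReal h0]
  gcongr
  exact ENNReal.rpow_le_self_of_le_one (by simpa using h1) (hp x hx)

theorem luxNorm_nonneg : 0 ≤ luxNorm Ω p f := Real.sInf_nonneg fun _ h => h.1.le

theorem luxNorm_le {γ : ℝ} (hγ : 0 < γ) (h : modular Ω p (fun x => γ⁻¹ • f x) ≤ 1) :
    luxNorm Ω p f ≤ γ :=
  csInf_le ⟨0, fun _ h => h.1.le⟩ ⟨hγ, h⟩

theorem modular_lt_one_of_luxNorm_lt (hm : MeasurableSet Ω) (hp : ∀ x ∈ Ω, 1 ≤ p x)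
    (hf : modular Ω p f < ⊤) {γ : ℝ} (h : luxNorm Ω p f < γ) :
    modular Ω p (fun x => γ⁻¹ • f x) < 1 := by
  have hne : {γ : ℝ | 0 < γ ∧ modular Ω p (fun x => γ⁻¹ • f x) ≤ 1}.Nonempty := by
    set m := (modular Ω p f).toReal
    have hm0 : 0 ≤ m := ENNReal.toReal_nonneg
    -- Scaling by `(m + 1)⁻¹ ≤ 1` brings the modular down to at most `m / (m + 1)`.
    refine ⟨m + 1, by positivity, ?_⟩
    refine (modular_smul_le hm hp (by positivity) (inv_le_one_of_one_le₀ (by linarith))).trans ?_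
    rw [← ENNReal.ofReal_toReal hf.ne, ← ENNReal.ofReal_mul (by positivity)]
    refine ENNReal.ofReal_le_one.2 ?_
    change (m + 1)⁻¹ * m ≤ 1
    rw [inv_mul_le_iff₀ (by positivity)]
    linarith
  obtain ⟨γ', ⟨h0, h1⟩, hlt⟩ := exists_lt_of_csInf_lt hne h
  have hγ : 0 < γ := h0.trans hlt
  -- Strictness comes from the extra factor `γ' / γ < 1`.
  have : (fun x => γ⁻¹ • f x) = fun x => (γ' / γ) • (γ'⁻¹ • f x) := by
    ext x
    rw [smul_smul]
    congr 1
    field_simp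
  rw [this]
  calc _ ≤ ENNReal.ofReal (γ' / γ) * modular Ω p (fun x => γ'⁻¹ • f x) :=
        modular_smul_le hm hp (by positivity) ((div_le_one hγ).2 hlt.le)
    _ ≤ ENNReal.ofReal (γ' / γ) := mul_le_of_le_one_right' h1
    _ < 1 := by
        rw [ENNReal.ofReal_lt_one, div_lt_one hγ]
        exact hlt

/-- The triangle inequality for the Luxemburg norm. -/
theorem luxNorm_add_le (hm : MeasurableSet Ω) (hpm : AEMeasurable p (volume.restrict Ω))
    (hp : ∀ x ∈ Ω, 1 ≤ p x) (hfm : AEStronglyMeasurable f (volume.restrict Ω))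
    (hf : modular Ω p f < ⊤) (hg : modular Ω p g < ⊤) :
    luxNorm Ω p (fun x => f x + g x) ≤ luxNorm Ω p f + luxNorm Ω p g := by
  refine le_of_forall_pos_le_add fun ε hε => ?_
  set a := luxNorm Ω p f + ε / 2 with ha
  set b := luxNorm Ω p g + ε / 2 with hb
  have ha0 : 0 < a := add_pos_of_nonneg_of_pos luxNorm_nonneg (by positivity)
  have hb0 : 0 < b := add_pos_of_nonneg_of_pos luxNorm_nonneg (by positivity)
  have hfa := modular_lt_one_of_luxNorm_lt hm hp hf (γ := a) (by linarith)
  have hgb := modular_lt_one_of_luxNorm_lt hm hp hg (γ := b) (by linarith)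
  -- `(f + g) / (a + b)` is a convex combination of `f / a` and `g / b` with these weights;
  -- convexity of `t ↦ t ^ p x` finishes.
  have hw : ENNReal.ofReal (a / (a + b)) + ENNReal.ofReal (b / (a + b)) = 1 := by
    rw [← ENNReal.ofReal_add (by positivity) (by positivity), ← add_div,
      div_self (by positivity), ENNReal.ofReal_one]
  have : luxNorm Ω p (fun x => f x + g x) ≤ a + b := by
    refine luxNorm_le (by positivity) ?_
    calc modular Ω p (fun x => (a + b)⁻¹ • (f x + g x))
        ≤ ∫⁻ x in Ω, (ENNReal.ofReal (a / (a + b)) * ‖a⁻¹ • f x‖ₑ ^ p x +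
            ENNReal.ofReal (b / (a + b)) * ‖b⁻¹ • g x‖ₑ ^ p x) := by
          refine setLIntegral_mono' hm fun x hx => ?_
          refine le_trans ?_ (ENNReal.rpow_arith_mean_le_arith_mean2_rpow _ _ _ _ hw (hp x hx))
          refine ENNReal.rpow_le_rpow ?_ (zero_le_one.trans (hp x hx))
          have : (a + b)⁻¹ • (f x + g x) =
              (a / (a + b)) • (a⁻¹ • f x) + (b / (a + b)) • (b⁻¹ • g x) := by
            rw [smul_smul, smul_smul, smul_add]
            congr 2 <;> field_simp
          dsimp only
          rw [this]
          refine (enorm_add_le _ _).trans (le_of_eq ?_)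
          rw [enorm_smul, enorm_smul (b / (a + b)), Real.enorm_eq_ofReal (by positivity),
            Real.enorm_eq_ofReal (by positivity : 0 ≤ b / (a + b))]
      _ = ENNReal.ofReal (a / (a + b)) * modular Ω p (fun x => a⁻¹ • f x) +
          ENNReal.ofReal (b / (a + b)) * modular Ω p (fun x => b⁻¹ • g x) := by
          rw [lintegral_add_left' ((aemeasurable_enorm_rpow
            (f := fun x => a⁻¹ • f x) hpm (hfm.const_smul a⁻¹)).const_mul _), lintegral_const_mul' _ _ ENNReal.ofReal_ne_top,
            lintegral_const_mul' _ _ ENNReal.ofReal_ne_top]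
          rfl
      _ ≤ ENNReal.ofReal (a / (a + b)) * 1 + ENNReal.ofReal (b / (a + b)) * 1 := by
          gcongr
      _ = 1 := by simpa using hw
  linarith

/-- The limit modular at scale `γ` is above one for `γ` below the limit norm and strictly below one
for `γ` above it. Both strict inequalities persist for large `n` and locate the norms. -/
theorem tendsto_luxNorm {P : ℕ → Eu N → ℝ} {G : ℕ → Eu N → F} (hm : MeasurableSet Ω)
    (hP : ∀ n, ∀ x ∈ Ω, 1 ≤ P n x) (hp : ∀ x ∈ Ω, 1 ≤ p x)
    (hG : ∀ n, modular Ω (P n) (G n) < ⊤) (hg : modular Ω p g < ⊤)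
    (h : ∀ γ : ℝ, 0 < γ → Tendsto (fun n => modular Ω (P n) (fun x => γ⁻¹ • G n x)) atTop
      (𝓝 (modular Ω p (fun x => γ⁻¹ • g x)))) :
    Tendsto (fun n => luxNorm Ω (P n) (G n)) atTop (𝓝 (luxNorm Ω p g)) := by
  refine tendsto_order.2 ⟨fun a ha => ?_, fun a ha => ?_⟩
  · rcases lt_or_ge a 0 with h0 | h0
    · exact Eventually.of_forall fun n => h0.trans_le luxNorm_nonneg
    obtain ⟨γ, haγ, hγ⟩ := exists_between ha
    have hγ0 := h0.trans_lt haγ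
    have h1 : 1 < modular Ω p (fun x => γ⁻¹ • g x) := by
      by_contra! hc
      exact hγ.not_ge (luxNorm_le hγ0 hc)
    filter_upwards [(h γ hγ0).eventually_const_lt h1] with n hn
    refine haγ.trans_le ?_
    by_contra! hc
    exact hn.not_gt (modular_lt_one_of_luxNorm_lt hm (hP n) (hG n) hc)
  · obtain ⟨γ, hγ, hγa⟩ := exists_between ha
    have hγ0 : 0 < γ := luxNorm_nonneg.trans_lt hγ
    filter_upwards [(h γ hγ0).eventually_lt_const
      (modular_lt_one_of_luxNorm_lt hm hp hg hγ)] with n hn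
    exact (luxNorm_le hγ0 hn.le).trans_lt hγa

end Modular

/-! ### Vitali convergence of modulars with varying exponents. -/

/-- With `A = ε ^ (-1 / (s - 1))`, every `t ≥ A` satisfies `ε * t ^ (s - 1) ≥ 1`. This is uniform
integrability in pointwise form. -/
theorem exists_le_min_add_mul_rpow {s : ℝ} (hs : 1 < s) {ε : ENNReal} (h0 : ε ≠ 0)
    (hT : ε ≠ ⊤) : ∃ A : ENNReal, A ≠ ⊤ ∧ ∀ t : ENNReal, t ≤ min t A + ε * t ^ s := by
  have hs' : 0 < s - 1 := by linarith
  refine ⟨(ε⁻¹) ^ (s - 1)⁻¹,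
    (ENNReal.rpow_lt_top_of_nonneg (by positivity) (ENNReal.inv_ne_top.2 h0)).ne, fun t => ?_⟩
  rcases le_total t ((ε⁻¹) ^ (s - 1)⁻¹) with h | h
  · rw [min_eq_left h]
    exact le_self_add
  · refine le_trans ?_ le_add_self
    have h1 : ε⁻¹ ≤ t ^ (s - 1) := by
      have := ENNReal.rpow_le_rpow h hs'.le
      rwa [← ENNReal.rpow_mul, inv_mul_cancel₀ hs'.ne', ENNReal.rpow_one] at this
    have h2 : t ^ s = t ^ (s - 1) * t := by
      conv_lhs => rw [← sub_add_cancel s 1]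
      rw [ENNReal.rpow_add_of_nonneg _ _ hs'.le zero_le_one, ENNReal.rpow_one]
    rw [h2, ← mul_assoc]
    calc t = ε * ε⁻¹ * t := by rw [ENNReal.mul_inv_cancel h0 hT, one_mul]
      _ ≤ ε * t ^ (s - 1) * t := by gcongr

/-- Vitali's convergence theorem for integrals, under a bound in a higher power. -/
theorem tendsto_lintegral_of_rpow_bound {α : Type*} [MeasurableSpace α] {μ : Measure α}
    [IsFiniteMeasure μ] {G : ℕ → α → ENNReal} {g : α → ENNReal}
    (hG : ∀ n, AEMeasurable (G n) μ) (hlim : ∀ᵐ x ∂μ, Tendsto (fun n => G n x) atTop (𝓝 (g x)))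
    {s : ℝ} (hs : 1 < s) {B : ENNReal} (hB : B ≠ ⊤) (hGB : ∀ n, ∫⁻ x, G n x ^ s ∂μ ≤ B) :
    Tendsto (fun n => ∫⁻ x, G n x ∂μ) atTop (𝓝 (∫⁻ x, g x ∂μ)) ∧ ∫⁻ x, g x ∂μ < ⊤ := by
  have hfatou : ∫⁻ x, g x ∂μ ≤ liminf (fun n => ∫⁻ x, G n x ∂μ) atTop :=
    (lintegral_congr_ae (hlim.mono fun x hx => hx.liminf_eq.symm)).trans_le
      (lintegral_liminf_le' hG)
  refine ⟨tendsto_of_le_liminf_of_limsup_le hfatou ?_, ?_⟩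
  -- Fatou gives the lower bound. For the upper one, the truncations at `A` converge by dominated
  -- convergence and the tails cost at most `ε`, uniformly in `n`.
  · refine ENNReal.le_of_forall_pos_le_add fun ε hε _ => ?_
    obtain ⟨e, he, heB⟩ := ENNReal.exists_nnreal_pos_mul_lt hB (ENNReal.coe_pos.2 hε).ne'
    obtain ⟨A, hA, hAt⟩ := exists_le_min_add_mul_rpow hs (ENNReal.coe_pos.2 he).ne'
      ENNReal.coe_ne_top
    have hle : ∀ n, ∫⁻ x, G n x ∂μ ≤ ∫⁻ x, min (G n x) A ∂μ + ε := fun n =>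
      calc ∫⁻ x, G n x ∂μ ≤ ∫⁻ x, (min (G n x) A + e * G n x ^ s) ∂μ :=
            lintegral_mono fun x => hAt _
        _ = ∫⁻ x, min (G n x) A ∂μ + e * ∫⁻ x, G n x ^ s ∂μ := by
            rw [lintegral_add_left' ((hG n).min aemeasurable_const),
              lintegral_const_mul' _ _ ENNReal.coe_ne_top]
        _ ≤ _ := by
            gcongr
            exact le_trans (by gcongr; exact hGB n) heB.le
    have htr : Tendsto (fun n => ∫⁻ x, min (G n x) A ∂μ + ε) atTop
        (𝓝 (∫⁻ x, min (g x) A ∂μ + ε)) := by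
      refine Tendsto.add ?_ tendsto_const_nhds
      refine tendsto_lintegral_of_dominated_convergence' (fun _ => A)
        (fun n => (hG n).min aemeasurable_const)
        (fun n => Eventually.of_forall fun x => min_le_right _ _) ?_
        (hlim.mono fun x hx => hx.min tendsto_const_nhds)
      rw [lintegral_const]
      exact ENNReal.mul_ne_top hA (measure_ne_top _ _)
    calc limsup (fun n => ∫⁻ x, G n x ∂μ) atTop
        ≤ limsup (fun n => ∫⁻ x, min (G n x) A ∂μ + ε) atTop :=
          limsup_le_limsup (Eventually.of_forall hle)
      _ = ∫⁻ x, min (g x) A ∂μ + ε := htr.limsup_eq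
      _ ≤ _ := by gcongr; exact min_le_left _ _
  · have hle : ∀ n, ∫⁻ x, G n x ∂μ ≤ μ univ + B := fun n =>
      calc ∫⁻ x, G n x ∂μ ≤ ∫⁻ x, (1 + G n x ^ s) ∂μ := lintegral_mono fun x => by
            simpa using rpow_le_one_add_rpow (G n x) zero_le_one hs.le
        _ = μ univ + ∫⁻ x, G n x ^ s ∂μ := by
            rw [lintegral_add_left measurable_const, lintegral_one]
        _ ≤ _ := by gcongr; exact hGB n
    refine (hfatou.trans ((liminf_le_limsup).trans (limsup_le_of_le ?_
      (Eventually.of_forall hle)))).trans_lt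
      (ENNReal.add_lt_top.2 ⟨measure_lt_top _ _, hB.lt_top⟩)
    isBoundedDefault

/-- Real powers are jointly continuous wherever the exponent is positive, also at base zero. -/
theorem tendsto_enorm_rpow {l : Filter ℕ} {a : ℕ → ℝ} {b : ℕ → ℝ} {x y : ℝ}
    (ha : Tendsto a l (𝓝 x)) (hb : Tendsto b l (𝓝 y)) (hy : 0 < y) :
    Tendsto (fun n => ‖a n‖ₑ ^ b n) l (𝓝 (‖x‖ₑ ^ y)) := by
  have h := (Real.continuousAt_rpow_of_pos (|x|, y) hy).tendsto.comp (ha.abs.prodMk_nhds hb)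
  have h2 := ENNReal.tendsto_ofReal h
  have key : ∀ c d : ℝ, 0 < d → ENNReal.ofReal (|c| ^ d) = ‖c‖ₑ ^ d := by
    intro c d hd
    rw [← ENNReal.ofReal_rpow_of_nonneg (abs_nonneg _) hd.le, ← Real.norm_eq_abs, ofReal_norm]
  rw [key x y hy] at h2
  refine h2.congr' ?_
  filter_upwards [hb.eventually_const_lt hy] with n hn
  exact key _ _ hn

/-- Convergence of the modulars along a sequence of exponents, for functions bounded in a
higher Lebesgue space and converging almost everywhere. -/
theorem tendsto_modular {Ω : Set (Eu N)} (hm : MeasurableSet Ω) (hV : volume Ω < ⊤)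
    {P : ℕ → Eu N → ℝ} {p : Eu N → ℝ} {S r : ℝ} (hSr : S < r)
    (hPm : ∀ n, AEMeasurable (P n) (volume.restrict Ω))
    (hP : ∀ n, ∀ x ∈ Ω, 1 ≤ P n x) (hPS : ∀ n, ∀ x ∈ Ω, P n x ≤ S) (hS : 0 < S)
    (hPp : ∀ x ∈ Ω, Tendsto (fun n => P n x) atTop (𝓝 (p x)))
    {G : ℕ → Eu N → ℝ} {g : Eu N → ℝ}
    (hG : ∀ n, AEStronglyMeasurable (G n) (volume.restrict Ω))
    (hlim : ∀ᵐ x ∂(volume.restrict Ω), Tendsto (fun n => G n x) atTop (𝓝 (g x)))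
    {M : ENNReal} (hM : M ≠ ⊤) (hGM : ∀ n, ∫⁻ x in Ω, ‖G n x‖ₑ ^ r ≤ M) :
    Tendsto (fun n => modular Ω (P n) (G n)) atTop (𝓝 (modular Ω p g)) ∧
      modular Ω p g < ⊤ := by
  have : IsFiniteMeasure (volume.restrict Ω) := ⟨by simpa using hV⟩
  -- The higher power is `r / S > 1`: since `P n x * (r / S) ≤ r`, it is controlled by `1 + ‖G n x‖ₑ
  -- ^ r`.
  refine tendsto_lintegral_of_rpow_bound (fun n => aemeasurable_enorm_rpow (hPm n) (hG n)) ?_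
    (s := r / S) ((one_lt_div hS).2 hSr) (B := volume Ω + M)
    (ENNReal.add_ne_top.2 ⟨hV.ne, hM⟩) fun n => ?_
  · filter_upwards [hlim, ae_restrict_mem hm] with x hx hxΩ
    exact tendsto_enorm_rpow hx (hPp x hxΩ)
      (zero_lt_one.trans_le (ge_of_tendsto' (hPp x hxΩ) fun n => hP n x hxΩ))
  · calc ∫⁻ x in Ω, (‖G n x‖ₑ ^ P n x) ^ (r / S) ≤ ∫⁻ x in Ω, (1 + ‖G n x‖ₑ ^ r) := by
          refine setLIntegral_mono' hm fun x hx => ?_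
          rw [← ENNReal.rpow_mul]
          have h1 := hP n x hx
          have hr : 0 < r := hS.trans hSr
          refine rpow_le_one_add_rpow _ (by positivity) ?_
          calc P n x * (r / S) ≤ S * (r / S) := by gcongr; exact hPS n x hx
            _ = r := by field_simp
      _ = volume Ω + ∫⁻ x in Ω, ‖G n x‖ₑ ^ r := by
          rw [lintegral_add_left measurable_const]; simp
      _ ≤ _ := by gcongr; exact hGM n

/-! ### Constant-exponent bounds and the Sobolev inequality. -/

theorem luxNorm_neg {F : Type*} [NormedAddCommGroup F] [NormedSpace ℝ F] {Ω : Set (Eu N)}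
    {p : Eu N → ℝ} (f : Eu N → F) : luxNorm Ω p (fun x => -f x) = luxNorm Ω p f := by
  simp [luxNorm, modular]

theorem modular_neg {F : Type*} [NormedAddCommGroup F] {Ω : Set (Eu N)}
    {p : Eu N → ℝ} (f : Eu N → F) : modular Ω p (fun x => -f x) = modular Ω p f := by
  simp [modular]

theorem enorm_gradient (φ : Eu N → ℝ) (x : Eu N) : ‖gradient φ x‖ₑ = ‖fderiv ℝ φ x‖ₑ := by
  rw [gradient, ← ofReal_norm, ← ofReal_norm, LinearIsometryEquiv.norm_map]

/-- A bound on the modular of `f / γ` controls every lower power of `f`. -/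
theorem lintegral_rpow_le_of_modular_le_one {F : Type*} [NormedAddCommGroup F] [NormedSpace ℝ F]
    {Ω : Set (Eu N)} {p : Eu N → ℝ} {f : Eu N → F} (hm : MeasurableSet Ω) {q γ : ℝ} (hq : 0 ≤ q)
    (hqp : ∀ x ∈ Ω, q ≤ p x) (hγ : 0 < γ) (h : modular Ω p (fun x => γ⁻¹ • f x) ≤ 1) :
    ∫⁻ x in Ω, ‖f x‖ₑ ^ q ≤ ENNReal.ofReal γ ^ q * (volume Ω + 1) := by
  have hfin : ENNReal.ofReal γ ^ q ≠ ⊤ :=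
    (ENNReal.rpow_lt_top_of_nonneg hq ENNReal.ofReal_ne_top).ne
  calc ∫⁻ x in Ω, ‖f x‖ₑ ^ q
      ≤ ∫⁻ x in Ω, ENNReal.ofReal γ ^ q * (1 + ‖γ⁻¹ • f x‖ₑ ^ p x) := by
        refine setLIntegral_mono' hm fun x hx => ?_
        have : f x = γ • (γ⁻¹ • f x) := by rw [smul_inv_smul₀ hγ.ne']
        conv_lhs => rw [this, enorm_smul, Real.enorm_eq_ofReal hγ.le,
          ENNReal.mul_rpow_of_nonneg _ _ hq]
        gcongr
        exact rpow_le_one_add_rpow _ hq (hqp x hx)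
    _ = ENNReal.ofReal γ ^ q * (volume Ω + modular Ω p (fun x => γ⁻¹ • f x)) := by
        rw [lintegral_const_mul' _ _ hfin, lintegral_add_left measurable_const]
        simp [modular]
    _ ≤ _ := by gcongr

theorem setLIntegral_eq_of_forall_notMem {Ω : Set (Eu N)} (hm : MeasurableSet Ω)
    {g : Eu N → ENNReal} (hg : ∀ x ∉ Ω, g x = 0) : ∫⁻ x in Ω, g x = ∫⁻ x, g x := by
  rw [← lintegral_indicator hm]
  congr 1 with x
  by_cases hx : x ∈ Ω <;> simp [hx, hg]

/-- The Gagliardo–Nirenberg–Sobolev inequality in integral form. -/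
theorem exists_lintegral_rpow_sobolevConj_le {q : ℝ} (hq : 1 ≤ q) (hqN : q < N) :
    ∃ C : ENNReal, C ≠ ⊤ ∧ ∀ φ : Eu N → ℝ, ContDiff ℝ 1 φ → HasCompactSupport φ →
      ∫⁻ x, ‖φ x‖ₑ ^ sobolevConj N q ≤
        (C * (∫⁻ x, ‖fderiv ℝ φ x‖ₑ ^ q) ^ q⁻¹) ^ sobolevConj N q := by
  have hq0 : 0 < q := by linarith
  have hr : 0 < sobolevConj N q := by
    have : (0 : ℝ) < N := hq0.trans hqN
    exact div_pos (by positivity) (by linarith)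
  lift q to NNReal using hq0.le
  obtain ⟨r, hr'⟩ : ∃ r : NNReal, (r : ℝ) = sobolevConj N q := ⟨⟨_, hr.le⟩, rfl⟩
  have hfr : Module.finrank ℝ (Eu N) = N := by simp
  refine ⟨SNormLESNormFDerivOfEqConst ℝ (volume : Measure (Eu N)) q, ENNReal.coe_ne_top,
    fun φ hφ hs => ?_⟩
  have hN0 : (0 : ℝ) < N := hq0.trans hqN
  have hgns := eLpNorm_le_eLpNorm_fderiv_of_eq (F := ℝ) (volume : Measure (Eu N)) hφ hs (p := q)
    (p' := r) (by exact_mod_cast hq) (by rw [hfr]; exact_mod_cast hN0) (by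
      rw [hfr, hr', sobolevConj]
      have : (N : ℝ) - q ≠ 0 := by linarith
      have : (q : ℝ) ≠ 0 := hq0.ne'
      push_cast
      field_simp)
  rw [← hr'] at hr ⊢
  rw [← eLpNorm_nnreal_pow_eq_lintegral (by exact_mod_cast hr.ne')]
  rw [← eLpNorm_nnreal_pow_eq_lintegral (by exact_mod_cast hq0.ne'), ← ENNReal.rpow_mul,
    mul_inv_cancel₀ hq0.ne', ENNReal.rpow_one]
  exact ENNReal.rpow_le_rpow hgns hr.le

/-! ### Uniform bounds on the exponents. -/

section Exponents

variable {Ω : Set (Eu N)} {p : Eu N → ℝ}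

/-- Supplies the boundedness without which real `sInf` and `sSup` do not bound the values of `p`. -/
theorem Admissible.isCompact_image (hp : Admissible Ω p) (hb : Bornology.IsBounded Ω) :
    IsCompact (p '' closure Ω) :=
  hb.isCompact_closure.image_of_continuousOn hp.continuousOn

theorem Admissible.expInf_le (hp : Admissible Ω p) (hb : Bornology.IsBounded Ω) {x : Eu N}
    (hx : x ∈ Ω) : expInf Ω p ≤ p x :=
  csInf_le ((hp.isCompact_image hb).bddBelow.mono (image_mono subset_closure))
    (mem_image_of_mem _ hx)

theorem Admissible.le_expSup (hp : Admissible Ω p) (hb : Bornology.IsBounded Ω) {x : Eu N}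
    (hx : x ∈ Ω) : p x ≤ expSup Ω p :=
  le_csSup ((hp.isCompact_image hb).bddAbove.mono (image_mono subset_closure))
    (mem_image_of_mem _ hx)

theorem Admissible.aemeasurable (hp : Admissible Ω p) (hm : MeasurableSet Ω) :
    AEMeasurable p (volume.restrict Ω) :=
  (hp.continuousOn.mono subset_closure).aemeasurable hm

variable {ph : ℕ → Eu N → ℝ} {hbar h : ℕ}

theorem tailInf_le_expInf (hph : ∀ h, Admissible Ω (ph h)) (hh : hbar ≤ h) :
    tailInf Ω ph hbar ≤ expInf Ω (ph h) := by
  refine csInf_le ⟨1, ?_⟩ (mem_image_of_mem _ hh)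
  rintro _ ⟨h, -, rfl⟩
  exact (hph h).one_lt.le

theorem expSup_le_tailSup (hph : ∀ h, Admissible Ω (ph h)) (hh : hbar ≤ h) :
    expSup Ω (ph h) ≤ tailSup Ω ph hbar := by
  refine le_csSup ⟨N, ?_⟩ (mem_image_of_mem _ hh)
  rintro _ ⟨h, -, rfl⟩
  exact (hph h).lt_dim.le

end Exponents

/-! ### Approximation by test functions and compactness. -/

/-- A function of `W₀^{1,p(x)}` is close to a test function whose gradient is controlled. -/
theorem MemW10.exists_test {Ω : Set (Eu N)} (hm : MeasurableSet Ω) (hV : volume Ω < ⊤)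
    {p : Eu N → ℝ} (hpm : AEMeasurable p (volume.restrict Ω)) {S : ℝ}
    (hp : ∀ x ∈ Ω, 1 ≤ p x) (hS : ∀ x ∈ Ω, p x ≤ S) {u : Eu N → ℝ} (hu : MemW10 Ω p u)
    {ε : ℝ} (hε : 0 < ε) :
    ∃ φ : Eu N → ℝ, IsTest Ω φ ∧ modular Ω p φ < ⊤ ∧
      modular Ω p (fun x => ε⁻¹ • (u x - φ x)) ≤ 1 ∧
      |luxNorm Ω p φ - luxNorm Ω p u| ≤ ε ∧
      ∀ C : ℝ, luxNorm Ω p (weakGrad Ω u) + ε ≤ C →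
        modular Ω p (fun x => C⁻¹ • gradient φ x) ≤ 1 := by
  obtain ⟨⟨⟨hum, hu1⟩, -, hGm, hG⟩, happ⟩ := hu
  obtain ⟨φ, hφ, hlt⟩ := happ ε hε
  have hφc : Continuous φ := hφ.1.continuous
  obtain ⟨C₁, hC₁⟩ := hφ.2.1.exists_bound_of_continuous hφc
  obtain ⟨C₂, hC₂⟩ := (hφ.2.1.fderiv ℝ).exists_bound_of_continuous
    (hφ.1.continuous_fderiv (by simp))
  have hC₂' : ∀ x, ‖gradient φ x‖ ≤ C₂ := fun x => by
    rw [gradient, LinearIsometryEquiv.norm_map]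
    exact hC₂ x
  have hφ1 : modular Ω p φ < ⊤ := modular_lt_top_of_bounded hm hV hp hS hC₁
  have hg1 : modular Ω p (gradient φ) < ⊤ := modular_lt_top_of_bounded hm hV hp hS hC₂'
  have hd : modular Ω p (fun x => u x - φ x) < ⊤ := by
    simp_rw [sub_eq_add_neg]
    exact modular_add_lt_top hm hpm hp hS hum hu1 (by rwa [modular_neg])
  have hD : modular Ω p (fun x => weakGrad Ω u x - gradient φ x) < ⊤ := by
    simp_rw [sub_eq_add_neg]
    exact modular_add_lt_top hm hpm hp hS hGm hG (by rwa [modular_neg])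
  -- Both norms being nonnegative, each is below `ε`, as their sum is.
  have hn1 : 0 ≤ luxNorm Ω p (fun x => u x - φ x) := luxNorm_nonneg
  have hn2 : 0 ≤ luxNorm Ω p (fun x => weakGrad Ω u x - gradient φ x) := luxNorm_nonneg
  have hum' : AEStronglyMeasurable (fun x => u x - φ x) (volume.restrict Ω) :=
    hum.sub hφc.aestronglyMeasurable
  refine ⟨φ, hφ, hφ1, (modular_lt_one_of_luxNorm_lt hm hp hd (by linarith)).le, ?_,
    fun C hC => ?_⟩
  · have h1 := luxNorm_add_le hm hpm hp hum' hd hφ1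
    have h2 := luxNorm_add_le (f := u) (g := fun x => -(u x - φ x)) hm hpm hp hum hu1
      (by rwa [modular_neg])
    rw [luxNorm_neg] at h2
    have e1 : (fun x => u x - φ x + φ x) = u := by ext x; ring
    have e2 : (fun x => u x + -(u x - φ x)) = φ := by ext x; ring
    rw [e1] at h1
    rw [e2] at h2
    rw [abs_le]
    constructor <;> linarith
  · have h2 := luxNorm_add_le (f := weakGrad Ω u)
      (g := fun x => -(weakGrad Ω u x - gradient φ x)) hm hpm hp hGm hG (by rwa [modular_neg])
    rw [luxNorm_neg] at h2
    have e2 : (fun x => weakGrad Ω u x + -(weakGrad Ω u x - gradient φ x)) = gradient φ := by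
      ext x; simp
    rw [e2] at h2
    exact (modular_lt_one_of_luxNorm_lt hm hp hg1 (by linarith)).le

theorem setLIntegral_enorm_le_add_rpow {F : Type*} [NormedAddCommGroup F] (Ω : Set (Eu N))
    (f : Eu N → F) {q : ℝ} (hq : 1 ≤ q) :
    ∫⁻ x in Ω, ‖f x‖ₑ ≤ volume Ω + ∫⁻ x in Ω, ‖f x‖ₑ ^ q :=
  calc ∫⁻ x in Ω, ‖f x‖ₑ ≤ ∫⁻ x in Ω, (1 + ‖f x‖ₑ ^ q) := lintegral_mono fun x => by
        simpa using rpow_le_one_add_rpow ‖f x‖ₑ zero_le_one hq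
    _ = _ := by rw [lintegral_add_left measurable_const]; simp

/-- Compactness for sequences bounded in `W₀^{1,P_n(x)}` when the exponents `P_n` stay in
`[q, S]` with `S` below the critical exponent of `q`. -/
theorem exists_subseq_tendsto_luxNorm {Ω : Set (Eu N)} (hm : MeasurableSet Ω)
    (hb : Bornology.IsBounded Ω) {P : ℕ → Eu N → ℝ} {p : Eu N → ℝ} {q S C : ℝ} (hq : 1 ≤ q)
    (hqN : q < N) (hS : 0 < S) (hSq : S < sobolevConj N q)
    (hPm : ∀ n, AEMeasurable (P n) (volume.restrict Ω)) (hqP : ∀ n, ∀ x ∈ Ω, q ≤ P n x)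
    (hPS : ∀ n, ∀ x ∈ Ω, P n x ≤ S)
    (hPp : ∀ x ∈ Ω, Tendsto (fun n => P n x) atTop (𝓝 (p x)))
    {u : ℕ → L1 Ω} (hu : ∀ n, MemW10 Ω (P n) (u n))
    (huC : ∀ n, luxNorm Ω (P n) (weakGrad Ω (u n)) ≤ C) :
    ∃ (s : ℕ → ℕ) (v : L1 Ω), StrictMono s ∧ Tendsto (fun j => u (s j)) atTop (𝓝 v) ∧
      MemLpVar Ω p v ∧
      Tendsto (fun j => luxNorm Ω (P (s j)) (u (s j))) atTop (𝓝 (luxNorm Ω p v)) := by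
  have hV : volume Ω < ⊤ := hb.measure_lt_top
  have hP1 : ∀ n, ∀ x ∈ Ω, 1 ≤ P n x := fun n x hx => hq.trans (hqP n x hx)
  have hp1 : ∀ x ∈ Ω, 1 ≤ p x := fun x hx => ge_of_tendsto' (hPp x hx) fun n => hP1 n x hx
  have hC0 : 0 ≤ C := luxNorm_nonneg.trans (huC 0)
  have hq0 : 0 ≤ q := by linarith
  have hr : 0 < sobolevConj N q := hS.trans hSq
  choose φ hφ hφfin hφu hφlux hφgrad using fun n =>
    (hu n).exists_test hm hV (hPm n) (hP1 n) (hPS n) (Nat.one_div_pos_of_nat (α := ℝ) (n := n))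
  have hφ1 : ∀ n, ContDiff ℝ 1 (φ n) := fun n => (hφ n).1.of_le (by exact_mod_cast le_top)
  have hφΩ : ∀ n, ∀ x ∉ Ω, φ n x = 0 := fun n x hx =>
    image_eq_zero_of_notMem_tsupport fun h => hx ((hφ n).2.2 h)
  have hdφΩ : ∀ n, ∀ x ∉ Ω, ‖fderiv ℝ (φ n) x‖ₑ = 0 := fun n x hx => by
    have h : fderiv ℝ (φ n) x = 0 :=
      Function.notMem_support.1 fun h => hx ((hφ n).2.2 (support_fderiv_subset ℝ h))
    rw [← ofReal_norm, h, norm_zero, ENNReal.ofReal_zero]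
  -- Bounds in `W^{1,q}` and in the Sobolev space.
  set D : ENNReal := ENNReal.ofReal (C + 1) ^ q * (volume Ω + 1)
  have hD : D ≠ ⊤ := ENNReal.mul_ne_top
    (ENNReal.rpow_lt_top_of_nonneg hq0 ENNReal.ofReal_ne_top).ne
    (ENNReal.add_ne_top.2 ⟨hV.ne, ENNReal.one_ne_top⟩)
  have hgradΩ : ∀ n, ∫⁻ x in Ω, ‖fderiv ℝ (φ n) x‖ₑ ^ q ≤ D := fun n => by
    simp_rw [← enorm_gradient]
    -- The error `1 / (n + 1)` is at most one, so the scale `C + 1` serves for all `n`.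
    refine lintegral_rpow_le_of_modular_le_one hm hq0 (hqP n) (by positivity) (hφgrad n _ ?_)
    refine add_le_add (huC n) ?_
    rw [div_le_one (by positivity)]
    linarith [n.cast_nonneg (α := ℝ)]
  have hgrad : ∀ n, ∫⁻ x, ‖fderiv ℝ (φ n) x‖ₑ ^ q ≤ D := fun n => by
    rw [← setLIntegral_eq_of_forall_notMem hm fun x hx => by
      rw [hdφΩ n x hx, ENNReal.zero_rpow_of_pos (by linarith)]]
    exact hgradΩ n
  obtain ⟨K, hK, hsob⟩ := exists_lintegral_rpow_sobolevConj_le hq hqN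
  set M : ENNReal := (K * D ^ q⁻¹) ^ sobolevConj N q with hMdef
  have hM : M ≠ ⊤ := (ENNReal.rpow_lt_top_of_nonneg hr.le (ENNReal.mul_ne_top hK
    (ENNReal.rpow_lt_top_of_nonneg (by positivity) hD).ne)).ne
  have hφM : ∀ n, ∫⁻ x in Ω, ‖φ n x‖ₑ ^ sobolevConj N q ≤ M := fun n => by
    refine (setLIntegral_le_lintegral _ _).trans ((hsob _ (hφ1 n) (hφ n).2.1).trans ?_)
    rw [hMdef]
    gcongr
    exact hgrad n
  have hr1 : 1 ≤ sobolevConj N q := by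
    rw [sobolevConj, one_le_div (by linarith)]
    nlinarith
  -- Extraction of the subsequence.
  obtain ⟨s₀, v, hs₀, hlim₀⟩ := exists_subseq_tendsto_lintegral hb hm hφ1
    (fun n => (hφ n).2.1) (M := volume Ω + M) (D := volume Ω + D)
    (ENNReal.add_ne_top.2 ⟨hV.ne, hM⟩) (ENNReal.add_ne_top.2 ⟨hV.ne, hD⟩)
    (fun n => by
      rw [← setLIntegral_eq_of_forall_notMem hm fun x hx => by rw [hφΩ n x hx, enorm_zero]]
      exact (setLIntegral_enorm_le_add_rpow Ω _ hr1).trans (by gcongr; exact hφM n))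
    (fun n => by
      rw [← setLIntegral_eq_of_forall_notMem hm (hdφΩ n)]
      exact (setLIntegral_enorm_le_add_rpow Ω _ hq).trans (by gcongr; exact hgradΩ n))
  have hφm : ∀ n, AEStronglyMeasurable (φ n) (volume.restrict Ω) := fun n =>
    (hφ1 n).continuous.aestronglyMeasurable
  -- `L¹` convergence gives almost everywhere convergence only after a further extraction `t`.
  have hmeas : TendstoInMeasure (volume.restrict Ω) (fun j => φ (s₀ j)) atTop v := by
    refine tendstoInMeasure_of_tendsto_eLpNorm one_ne_zero (fun j => hφm _)
      (Lp.aestronglyMeasurable v) ?_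
    simpa only [eLpNorm_one_eq_lintegral_enorm, Pi.sub_apply] using hlim₀
  obtain ⟨t, ht, hae⟩ := hmeas.exists_seq_tendsto_ae
  set s : ℕ → ℕ := fun j => s₀ (t j)
  have hs : StrictMono s := hs₀.comp ht
  have hlim : Tendsto (fun j => ∫⁻ x in Ω, ‖φ (s j) x - v x‖ₑ) atTop (𝓝 0) :=
    hlim₀.comp ht.tendsto_atTop
  have hε : Tendsto (fun j => 1 / ((s j : ℝ) + 1)) atTop (𝓝 0) :=
    tendsto_one_div_add_atTop_nhds_zero_nat.comp hs.tendsto_atTop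
  -- Convergence of the modulars and of the norms.
  have hmod : ∀ γ : ℝ, Tendsto (fun j => modular Ω (P (s j)) (fun x => γ⁻¹ • φ (s j) x)) atTop
      (𝓝 (modular Ω p (fun x => γ⁻¹ • v x))) ∧ modular Ω p (fun x => γ⁻¹ • v x) < ⊤ := fun γ =>
    tendsto_modular hm hV hSq (fun j => hPm _) (fun j => hP1 _) (fun j => hPS _) hS
      (fun x hx => (hPp x hx).comp hs.tendsto_atTop) (fun j => (hφm _).const_smul γ⁻¹)
      (hae.mono fun x hx => hx.const_smul γ⁻¹) (M := ‖γ⁻¹‖ₑ ^ sobolevConj N q * M)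
      (ENNReal.mul_ne_top (ENNReal.rpow_lt_top_of_nonneg hr.le enorm_ne_top).ne hM) fun j => by
        simp_rw [enorm_smul, ENNReal.mul_rpow_of_nonneg _ _ hr.le]
        rw [lintegral_const_mul' _ _ (ENNReal.rpow_lt_top_of_nonneg hr.le enorm_ne_top).ne]
        gcongr
        exact hφM _
  have hvfin : modular Ω p v < ⊤ := by simpa using (hmod 1).2
  have hlux : Tendsto (fun j => luxNorm Ω (P (s j)) (φ (s j))) atTop (𝓝 (luxNorm Ω p v)) :=
    tendsto_luxNorm hm (fun j => hP1 _) hp1 (fun j => hφfin _) hvfin fun γ _ => (hmod γ).1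
  refine ⟨s, v, hs, ?_, ⟨Lp.aestronglyMeasurable v, hvfin⟩, ?_⟩
  · rw [Lp.tendsto_Lp_iff_tendsto_eLpNorm']
    have hup : Tendsto (fun j => ENNReal.ofReal (1 / ((s j : ℝ) + 1)) * (volume Ω + 1) +
        ∫⁻ x in Ω, ‖φ (s j) x - v x‖ₑ) atTop (𝓝 0) := by
      have h1 := ENNReal.Tendsto.mul_const (b := volume Ω + 1) (ENNReal.tendsto_ofReal hε)
        (Or.inr (ENNReal.add_ne_top.2 ⟨hV.ne, ENNReal.one_ne_top⟩))
      simpa using h1.add hlim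
    refine tendsto_of_tendsto_of_tendsto_of_le_of_le tendsto_const_nhds hup
      (fun _ => zero_le) fun j => ?_
    -- The power bound is used with exponent one.
    have h1 : ∫⁻ x in Ω, ‖u (s j) x - φ (s j) x‖ₑ ≤
        ENNReal.ofReal (1 / ((s j : ℝ) + 1)) * (volume Ω + 1) := by
      simpa using lintegral_rpow_le_of_modular_le_one hm zero_le_one (hP1 (s j))
        Nat.one_div_pos_of_nat (hφu (s j))
    dsimp only
    rw [eLpNorm_one_eq_lintegral_enorm]
    calc ∫⁻ x in Ω, ‖(⇑(u (s j)) - ⇑v) x‖ₑ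
        ≤ ∫⁻ x in Ω, (‖u (s j) x - φ (s j) x‖ₑ + ‖φ (s j) x - v x‖ₑ) := by
          refine lintegral_mono fun x => ?_
          rw [Pi.sub_apply, ← sub_add_sub_cancel (u (s j) x) (φ (s j) x) (v x)]
          exact enorm_add_le _ _
      _ = (∫⁻ x in Ω, ‖u (s j) x - φ (s j) x‖ₑ) + ∫⁻ x in Ω, ‖φ (s j) x - v x‖ₑ :=
          lintegral_add_left'
            ((Lp.aestronglyMeasurable (u (s j))).sub (hφm (s j))).enorm _
      _ ≤ _ := by gcongr
  · have hdiff : Tendsto (fun j => luxNorm Ω (P (s j)) (φ (s j)) -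
        luxNorm Ω (P (s j)) (u (s j))) atTop (𝓝 0) :=
      squeeze_zero_norm (fun j => hφlux (s j)) hε
    simpa using hlux.sub hdiff

end VarExp
end

/-! ### The theorem. -/

theorem theorem2p10 {N : ℕ} (hN : 2 ≤ N) (Ω : Set (VarExp.Eu N))
    (hΩ : VarExp.IsBoundedLipschitzDomain Ω)
    (p : VarExp.Eu N → ℝ) (hp : VarExp.Admissible Ω p)
    (ph : ℕ → VarExp.Eu N → ℝ) (hph : ∀ h, VarExp.Admissible Ω (ph h))
    (hconv : ∀ x ∈ Ω, Tendsto (fun h => ph h x) atTop (𝓝 (p x)))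
    (hbar : ℕ)
    (hlow : 1 < VarExp.tailInf Ω ph hbar)
    (hup : VarExp.tailSup Ω ph hbar < VarExp.sobolevConj N (VarExp.tailInf Ω ph hbar))
    (k : ℕ → ℕ) (hk : StrictMono k)
    (u : ℕ → VarExp.L1 Ω)
    (hbdd : (⨆ n, VarExp.energy Ω (ph (k n)) (u n)) < ⊤) :
    ∃ (s : ℕ → ℕ) (v : VarExp.L1 Ω), StrictMono s ∧
      Tendsto (fun j => u (s j)) atTop (𝓝 v) ∧
      VarExp.MemLpVar Ω p v ∧
      Tendsto (fun j => VarExp.gNorm Ω (ph (k (s j))) (u (s j))) atTop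
        (𝓝 (VarExp.gNorm Ω p v)) := by
  have hb := hΩ.isBounded
  have hm := hΩ.isOpen.measurableSet
  have hle : ∀ n, VarExp.energy Ω (ph (k n)) (u n) ≤
      ⨆ n, VarExp.energy Ω (ph (k n)) (u n) :=
    le_iSup (fun n => VarExp.energy Ω (ph (k n)) (u n))
  have hmem : ∀ n, VarExp.MemW10 Ω (ph (k n)) (u n) := fun n => by
    by_contra hc
    exact ((hle n).trans_lt hbdd).ne (if_neg hc)
  have hnorm : ∀ n, VarExp.luxNorm Ω (ph (k n)) (VarExp.weakGrad Ω (u n)) ≤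
      (⨆ n, VarExp.energy Ω (ph (k n)) (u n)).toReal := fun n => by
    have h := hle n
    rw [VarExp.energy, if_pos (hmem n)] at h
    exact (ENNReal.ofReal_le_iff_le_toReal hbdd.ne).1 h
  -- Since `k n ≥ n`, a shift by `hbar` puts every index in the range of the tail bounds; the shift
  -- is put back in the final subsequence.
  have hkn : ∀ n, hbar ≤ k (n + hbar) := fun n => (Nat.le_add_left _ _).trans (hk.le_apply)
  have hqP : ∀ n, ∀ x ∈ Ω, VarExp.tailInf Ω ph hbar ≤ ph (k (n + hbar)) x := fun n x hx =>
    (VarExp.tailInf_le_expInf hph (hkn n)).trans ((hph _).expInf_le hb hx)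
  have hPS : ∀ n, ∀ x ∈ Ω, ph (k (n + hbar)) x ≤ VarExp.tailSup Ω ph hbar := fun n x hx =>
    ((hph _).le_expSup hb hx).trans (VarExp.expSup_le_tailSup hph (hkn n))
  obtain ⟨x₀, hx₀⟩ := hΩ.isConnected.nonempty
  have hqN : VarExp.tailInf Ω ph hbar < N :=
    (hqP 0 x₀ hx₀).trans_lt (((hph _).le_expSup hb hx₀).trans_lt (hph _).lt_dim)
  have hS : 0 < VarExp.tailSup Ω ph hbar := by
    linarith [hqP 0 x₀ hx₀, hPS 0 x₀ hx₀]
  obtain ⟨s, v, hs, hlim, hv, hlux⟩ := VarExp.exists_subseq_tendsto_luxNorm hm hb hlow.le hqN hS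
    hup (P := fun n => ph (k (n + hbar))) (fun n => (hph _).aemeasurable hm) hqP hPS
    (fun x hx => (hconv x hx).comp
      (hk.tendsto_atTop.comp (tendsto_add_atTop_nat hbar)))
    (u := fun n => u (n + hbar)) (fun n => hmem _) (fun n => hnorm _)
  refine ⟨fun j => s j + hbar, v, hs.add_const hbar, hlim, hv, ?_⟩
  -- The default value `0` of `gNorm` never occurs, all functions being in their Lebesgue spaces.
  simpa only [VarExp.gNorm, if_pos hv, if_pos (hmem _).1.1] using hlux
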